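/- For each $n \ge 1$ let $A_n$ be an $n\times n$ complex Hermitian matrix with $(A_n)_{i,i}=0$ for all $i\in\{1,\dots,n\}$. Let $\mu_{A_n}=\frac1n\sum_{i=1}^n\delta_{\lambda_i(A_n)}$ be the empirical distribution of its eigenvalues $\lambda_1(A_n),\dots,\lambda_n(A_n)$, counted with multiplicity. Assume that $\mu_{A_n}$ converges weakly to the Dirac mass $\delta_0$ as $n\to\infty$, and that $\limsup_{n\to\infty} \frac1n \operatorname{tr}(A_n^2)<+\infty$. Let $\mu=\mu_n$ be the uniform probability measure on $\{-1,1\}^n\subset\mathbb R^n$. For $\lambda, x\in\mathbb R^n$ put $$\Lambda_\mu(\lambda)=\log\int e^{\langle\lambda,y\rangle}\,d\mu(y),\qquad \Lambda_\mu^*(x)=\sup_{\lambda\in\mathbb R^n}\{\langle\lambda,x\rangle-\Lambda_\mu(\lambda)\}.$$ Then, as $n\to\infty$, $$\log\int e^{\langle\sigma,A_n\sigma\rangle}\,d\mu(\sigma)=\sup_{x\in[-1,1]^n}\big\{\langle x,A_nx\rangle-\Lambda_\mu^*(x)\big\}+o(n).$$ -/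

import Mathlib

open MeasureTheory ProbabilityTheory Filter Topology
open scoped NNReal ENNReal RealInnerProductSpace

noncomputable section

namespace MeanFieldIsing

/-- The empirical distribution `(1 / n) ∑ i, δ_{λ i}` of the eigenvalues (with multiplicity) of an
`n × n` complex Hermitian matrix. For `1 ≤ n` it has mass one; for `n = 0` it is the zero measure.
The topology of `FiniteMeasure ℝ` is that of weak convergence. -/
def empiricalSpectralMeasure {n : ℕ} {A : Matrix (Fin n) (Fin n) ℂ} (hA : A.IsHermitian) :
    FiniteMeasure ℝ :=
  (n : ℝ≥0)⁻¹ • ∑ i : Fin n, (diracProba (hA.eigenvalues i)).toFiniteMeasure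

/-- The discrete hypercube `{-1, 1}^n` inside `ℝ^n`. -/
def discreteCube (n : ℕ) : Set (EuclideanSpace ℝ (Fin n)) :=
  {σ | ∀ i, σ i = -1 ∨ σ i = 1}

/-- The solid cube `[-1, 1]^n` inside `ℝ^n`. -/
def solidCube (n : ℕ) : Set (EuclideanSpace ℝ (Fin n)) :=
  {x | ∀ i, x i ∈ Set.Icc (-1 : ℝ) 1}

/-- The uniform probability measure on `{-1, 1}^n`, as a measure on `ℝ^n`. -/
def uniformCube (n : ℕ) : Measure (EuclideanSpace ℝ (Fin n)) :=
  uniformOn (discreteCube n)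

/-- The logarithmic Laplace transform `Λ_μ(l) = log ∫ exp ⟨l, x⟩ dμ(x)`, which may be `+∞`. -/
def logLaplace {n : ℕ} (μ : Measure (EuclideanSpace ℝ (Fin n)))
    (l : EuclideanSpace ℝ (Fin n)) : EReal :=
  ENNReal.log (∫⁻ x, ENNReal.ofReal (Real.exp ⟪l, x⟫) ∂μ)

/-- The Legendre transform `Λ*_μ(x) = sup_l (⟨l, x⟩ - Λ_μ(l))`, which may be `+∞`. -/
def legendre {n : ℕ} (μ : Measure (EuclideanSpace ℝ (Fin n)))
    (x : EuclideanSpace ℝ (Fin n)) : EReal :=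
  ⨆ l : EuclideanSpace ℝ (Fin n), ((⟪l, x⟫ : ℝ) : EReal) - logLaplace μ l

/-- The quadratic form `⟨x, A x⟩` at a real vector `x`. For Hermitian `A` the complex number
`x* A x` is real, and the real part only changes its type. -/
def quadForm {n : ℕ} (A : Matrix (Fin n) (Fin n) ℂ) (x : EuclideanSpace ℝ (Fin n)) : ℝ :=
  (star (fun i => (x i : ℂ)) ⬝ᵥ A.mulVec (fun i => (x i : ℂ))).re

end MeanFieldIsing

end

/-!
The free energy and its mean-field value are compared for each `n` by two finite-dimensional
inequalities.

*Lower bound* (`quadratic_sub_legendre_le`). For `y` in the open cube, the product measure on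
`{-1, 1}^n` with mean `y` has density `∏ (1 + y i σ i)`, proportional to `exp ⟪l, σ⟫` with
`l = artanh y`. As the matrix has no diagonal, the mean of the quadratic form `q` under this measure
is `q y`, so Jensen's inequality shows that the free energy is at least `q y - (⟪l, y⟫ - Λ(l))`, hence
at least `q y - Λ*(y)`. The boundary follows by scaling. Thus the error term is nonnegative.

*Upper bound* (`exists_log_cubeAvg_le`). Write `q x = ∑ λ j ⟪f j, x⟫ ^ 2`, where the `f j` are the
real and imaginary parts of the eigenvectors, a Parseval frame of `ℝ^n`. Fix `ε`, and cut the cube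
into cells on which `⟪f j, σ⟫` is almost constant for each of the few indices with `|λ j| > ε`. On
one cell let `y` be the mean of the Gibbs measure conditioned on it. The mean of `q` differs from
`q y` by `∑ λ j Var ⟪f j, σ⟫`, which is at most `2 ε n` (`sum_cell_quadratic_sub_le`), and Jensen's
inequality against every `exp ⟪l, ·⟫` bounds the logarithm of the mass of the cell by
`q y - Λ*(y) + 2 ε n`. It remains to count cells. An exponential-moment estimate
(`card_le_exp_of_sum_mul_abs_le`, `card_image_spectralCell_le`) bounds the logarithm of their number
by a multiple of `δ n + ε⁻¹ ∑ |λ j|`, the sum being over the at most `δ n` indices with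
`|λ j| > ε`; by Cauchy–Schwarz this sum is at most a multiple of `√(δ n tr A²)`.

In the limit, weak convergence to `δ₀` makes the proportion `δ` of large eigenvalues as small as
desired (`eventually_card_eigenvalues_le`), and `tr A² = O(n)`, so that all errors are `o(n)`.
-/

namespace MeanFieldIsing

/-! ### Finite sums: lattice points in `ℓ¹` balls, Jensen, pigeonhole, variance -/

theorem sum_exp_neg_mul_abs_Icc_le {a : ℝ} (ha : 0 < a) (L : ℕ) :
    ∑ m ∈ Finset.Icc (-(L : ℤ)) L, Real.exp (-(a * |(m : ℝ)|)) ≤ 1 + 2 / a := by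
  -- The subtracted term makes the bound inductive: the increment `2 exp (-a (L + 1))` is at most
  -- the increment of the right-hand side because `a ≤ exp a - 1`.
  have key : ∀ L : ℕ, ∑ m ∈ Finset.Icc (-(L : ℤ)) L, Real.exp (-(a * |(m : ℝ)|)) ≤
      1 + 2 / a * (1 - Real.exp (-(a * L))) := by
    intro L
    induction L with
    | zero => simp
    | succ k ih =>
      have hset : Finset.Icc (-((k + 1 : ℕ) : ℤ)) ((k + 1 : ℕ) : ℤ) =
          insert (-((k : ℤ) + 1)) (insert ((k : ℤ) + 1) (Finset.Icc (-(k : ℤ)) k)) := by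
        ext m; simp only [Finset.mem_Icc, Finset.mem_insert]; omega
      have h1 : (-((k : ℤ) + 1)) ∉ insert ((k : ℤ) + 1) (Finset.Icc (-(k : ℤ)) k) := by
        simp only [Finset.mem_Icc, Finset.mem_insert]; omega
      have h2 : ((k : ℤ) + 1) ∉ Finset.Icc (-(k : ℤ)) (k : ℤ) := by
        simp only [Finset.mem_Icc]; omega
      rw [hset, Finset.sum_insert h1, Finset.sum_insert h2]
      push_cast
      have habs : |-((k : ℝ) + 1)| = (k : ℝ) + 1 := by rw [abs_neg, abs_of_nonneg (by positivity)]
      have habs' : |(k : ℝ) + 1| = (k : ℝ) + 1 := abs_of_nonneg (by positivity)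
      rw [habs, habs']
      have hexp : Real.exp (-(a * k)) = Real.exp (-(a * (k + 1))) * Real.exp a := by
        rw [← Real.exp_add]; ring_nf
      rw [hexp] at ih
      have h3 : a + 1 ≤ Real.exp a := Real.add_one_le_exp a
      have h4 : 2 * Real.exp (-(a * (k + 1))) ≤
          2 / a * (Real.exp (-(a * (k + 1))) * Real.exp a - Real.exp (-(a * (k + 1)))) := by
        rw [div_mul_eq_mul_div, le_div_iff₀ ha]
        nlinarith [Real.exp_pos (-(a * ((k : ℝ) + 1)))]
      linarith
  refine (key L).trans ?_
  have : 2 / a * (1 - Real.exp (-(a * L))) ≤ 2 / a * 1 := by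
    gcongr
    linarith [Real.exp_pos (-(a * (L : ℝ)))]
  linarith

/-- An exponential-moment bound for the number of integer points in a weighted `ℓ¹` ball: each
point has weight `exp (K - ∑ a j |m j|) ≥ 1`, and the total weight factorises. -/
theorem card_le_exp_of_sum_mul_abs_le {κ : Type*} [Fintype κ]
    (S : Finset (κ → ℤ)) {a : κ → ℝ} (ha : ∀ j, 0 < a j) {K : ℝ}
    (hS : ∀ m ∈ S, ∑ j, a j * |(m j : ℝ)| ≤ K) :
    (S.card : ℝ) ≤ Real.exp (K + ∑ j, 2 / a j) := by
  classical
  -- A finite box containing `S`, over which the sum of the weights factorises.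
  obtain ⟨L, hL⟩ : ∃ L : ℕ, ∀ m ∈ S, ∀ j, (m j).natAbs ≤ L := by
    refine ⟨∑ m ∈ S, ∑ j, (m j).natAbs, fun m hm j => ?_⟩
    exact (Finset.single_le_sum (f := fun j => (m j).natAbs) (fun _ _ => Nat.zero_le _)
      (Finset.mem_univ j)).trans
      (Finset.single_le_sum (f := fun m : κ → ℤ => ∑ j, (m j).natAbs) (fun _ _ => Nat.zero_le _) hm)
  have hsub : S ⊆ Fintype.piFinset (fun _ : κ => Finset.Icc (-(L : ℤ)) L) := by
    intro m hm
    rw [Fintype.mem_piFinset]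
    intro j
    have := hL m hm j
    rw [Finset.mem_Icc]; omega
  calc (S.card : ℝ) = ∑ m ∈ S, (1 : ℝ) := by simp
    _ ≤ ∑ m ∈ S, Real.exp K * ∏ j, Real.exp (-(a j * |(m j : ℝ)|)) := by
        refine Finset.sum_le_sum fun m hm => ?_
        rw [← Real.exp_sum, ← Real.exp_add, Finset.sum_neg_distrib]
        exact Real.one_le_exp (by linarith [hS m hm])
    _ ≤ ∑ m ∈ Fintype.piFinset (fun _ : κ => Finset.Icc (-(L : ℤ)) L),
          Real.exp K * ∏ j, Real.exp (-(a j * |(m j : ℝ)|)) :=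
        Finset.sum_le_sum_of_subset_of_nonneg hsub fun _ _ _ => by positivity
    _ = Real.exp K * ∏ j, ∑ m ∈ Finset.Icc (-(L : ℤ)) L, Real.exp (-(a j * |(m : ℝ)|)) := by
        rw [← Finset.mul_sum, Finset.prod_univ_sum]
    _ ≤ Real.exp K * ∏ j, Real.exp (2 / a j) := by
        gcongr with j
        refine (sum_exp_neg_mul_abs_Icc_le (ha j) L).trans ?_
        linarith [Real.add_one_le_exp (2 / a j)]
    _ = Real.exp (K + ∑ j, 2 / a j) := by rw [← Real.exp_sum, ← Real.exp_add]

/-- Jensen's inequality for `exp` and a finite measure that need not be normalised. -/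
theorem sum_mul_exp_div_le {α : Type*} (S : Finset α) {w g : α → ℝ} (hw : ∀ s ∈ S, 0 ≤ w s)
    (hW : 0 < ∑ s ∈ S, w s) :
    (∑ s ∈ S, w s) * Real.exp ((∑ s ∈ S, w s * g s) / ∑ s ∈ S, w s) ≤
      ∑ s ∈ S, w s * Real.exp (g s) := by
  set W := ∑ s ∈ S, w s with hWdef
  have h := convexOn_exp.map_sum_le (t := S) (w := fun s => w s / W) (p := g)
    (fun s hs => div_nonneg (hw s hs) hW.le) (by rw [← Finset.sum_div, div_self hW.ne'])
    (fun _ _ => Set.mem_univ _)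
  simp only [smul_eq_mul, div_mul_eq_mul_div, ← Finset.sum_div] at h
  rwa [le_div_iff₀ hW, mul_comm] at h

/-- A finite sum of nonnegative terms is at most the number of classes of a partition times the
largest partial sum over a class. -/
theorem exists_sum_le_card_mul_sum_fiber {α β : Type*} [Fintype α] [Nonempty α] [DecidableEq β]
    (c : α → β) (w : α → ℝ) :
    ∃ b : β, (Finset.univ.filter fun s => c s = b).Nonempty ∧
      ∑ s, w s ≤ (Finset.univ.image c).card * ∑ s with c s = b, w s := by
  obtain ⟨b, hb, hmax⟩ := (Finset.univ.image c).exists_max_image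
    (fun b => ∑ s with c s = b, w s) (Finset.univ_nonempty.image c)
  refine ⟨b, ?_, ?_⟩
  · obtain ⟨s, -, hs⟩ := Finset.mem_image.1 hb
    exact ⟨s, by simp [hs]⟩
  · rw [← Finset.sum_fiberwise_of_maps_to (t := Finset.univ.image c) (g := c)
      (fun s _ => Finset.mem_image_of_mem c (Finset.mem_univ s)), ← nsmul_eq_mul]
    exact Finset.sum_le_card_nsmul _ _ _ hmax

/-- The variance is at most the mean squared distance to any constant. -/
theorem sum_mul_sq_sub_le {α : Type*} (S : Finset α) {w : α → ℝ}
    (hW : 0 < ∑ s ∈ S, w s) (g : α → ℝ) (c : ℝ) :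
    (∑ s ∈ S, w s * g s ^ 2) / (∑ s ∈ S, w s) - ((∑ s ∈ S, w s * g s) / ∑ s ∈ S, w s) ^ 2 ≤
      (∑ s ∈ S, w s * (g s - c) ^ 2) / ∑ s ∈ S, w s := by
  have h : ∑ s ∈ S, w s * (g s - c) ^ 2 =
      ∑ s ∈ S, w s * g s ^ 2 - 2 * c * ∑ s ∈ S, w s * g s + c ^ 2 * ∑ s ∈ S, w s := by
    rw [Finset.mul_sum, Finset.mul_sum, ← Finset.sum_sub_distrib, ← Finset.sum_add_distrib]
    exact Finset.sum_congr rfl fun s _ => by ring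
  rw [h]
  set W := ∑ s ∈ S, w s
  set P := ∑ s ∈ S, w s * g s
  have : (∑ s ∈ S, w s * g s ^ 2 - 2 * c * P + c ^ 2 * W) / W =
      (∑ s ∈ S, w s * g s ^ 2) / W - 2 * c * (P / W) + c ^ 2 := by
    field_simp
  rw [this]
  nlinarith [sq_nonneg (P / W - c)]

theorem sum_mul_sq_sub_nonneg {α : Type*} (S : Finset α) {w : α → ℝ} (hw : ∀ s ∈ S, 0 ≤ w s)
    (hW : 0 < ∑ s ∈ S, w s) (g : α → ℝ) :
    0 ≤ (∑ s ∈ S, w s * g s ^ 2) / (∑ s ∈ S, w s) -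
      ((∑ s ∈ S, w s * g s) / ∑ s ∈ S, w s) ^ 2 := by
  have h := Finset.sum_mul_sq_le_sq_mul_sq S (fun s => √(w s)) (fun s => √(w s) * g s)
  have e1 : ∑ s ∈ S, √(w s) * (√(w s) * g s) = ∑ s ∈ S, w s * g s :=
    Finset.sum_congr rfl fun s hs => by rw [← mul_assoc, Real.mul_self_sqrt (hw s hs)]
  have e2 : ∑ s ∈ S, √(w s) ^ 2 = ∑ s ∈ S, w s :=
    Finset.sum_congr rfl fun s hs => Real.sq_sqrt (hw s hs)
  have e3 : ∑ s ∈ S, (√(w s) * g s) ^ 2 = ∑ s ∈ S, w s * g s ^ 2 :=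
    Finset.sum_congr rfl fun s hs => by rw [mul_pow, Real.sq_sqrt (hw s hs)]
  rw [e1, e2, e3] at h
  rw [sub_nonneg, div_pow, div_le_div_iff₀ (by positivity) hW]
  nlinarith

/-! ### The uniform measure on the discrete cube -/

/-- The vertex of `{-1, 1}^n` encoded by a Boolean vector. -/
noncomputable def signVec {n : ℕ} (s : Fin n → Bool) : EuclideanSpace ℝ (Fin n) :=
  WithLp.toLp 2 fun i => if s i then 1 else -1

theorem signVec_apply {n : ℕ} (s : Fin n → Bool) (i : Fin n) :
    signVec s i = if s i then 1 else -1 := rfl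

theorem signVec_injective {n : ℕ} : Function.Injective (signVec (n := n)) := by
  intro s t h
  funext i
  have := congrArg (fun x : EuclideanSpace ℝ (Fin n) => x i) h
  simp only [signVec_apply] at this
  cases hs : s i <;> cases ht : t i <;> simp [hs, ht] at this ⊢ <;> norm_num at this

theorem norm_sq_signVec {n : ℕ} (s : Fin n → Bool) : ‖signVec s‖ ^ 2 = n := by
  rw [EuclideanSpace.real_norm_sq_eq]
  have : ∀ i, signVec s i ^ 2 = 1 := fun i => by rw [signVec_apply]; split_ifs <;> norm_num
  simp [this]

/-- The average of `f` over the vertices of the discrete cube. -/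
noncomputable def cubeAvg {n : ℕ} (f : EuclideanSpace ℝ (Fin n) → ℝ) : ℝ :=
  ((2 : ℝ) ^ n)⁻¹ * ∑ s : Fin n → Bool, f (signVec s)

theorem discreteCube_eq {n : ℕ} :
    discreteCube n = ((Finset.univ.image (signVec (n := n)) : Finset _) : Set _) := by
  ext x
  simp only [discreteCube, Set.mem_ofPred_eq, Finset.coe_image, Finset.coe_univ, Set.image_univ,
    Set.mem_range]
  constructor
  · intro h
    refine ⟨fun i => decide (x i = 1), ?_⟩
    ext i
    rw [signVec_apply]
    rcases h i with h | h <;> rw [h] <;> norm_num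
  · rintro ⟨s, rfl⟩ i
    rw [signVec_apply]
    split_ifs <;> simp

theorem uniformCube_eq (n : ℕ) : uniformCube n =
    ((2 : ℝ≥0∞) ^ n)⁻¹ • (Measure.count.restrict
      ((Finset.univ.image (signVec (n := n)) : Finset _) : Set (EuclideanSpace ℝ (Fin n)))) := by
  rw [uniformCube, uniformOn, ProbabilityTheory.cond, discreteCube_eq, Measure.count_apply_finset,
    Finset.card_image_of_injective _ signVec_injective]
  simp

theorem integrableOn_count_finset {α : Type*} [MeasurableSpace α] [MeasurableSingletonClass α]
    (s : Finset α) (f : α → ℝ) : IntegrableOn f s Measure.count := by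
  rw [← (s : Set α).biUnion_of_singleton]
  simp [integrableOn_finset_iUnion]

theorem integrable_uniformCube {n : ℕ} (f : EuclideanSpace ℝ (Fin n) → ℝ) :
    Integrable f (uniformCube n) := by
  rw [uniformCube_eq]
  exact Integrable.smul_measure (integrableOn_count_finset _ f) (by simp)

theorem integral_uniformCube {n : ℕ} (f : EuclideanSpace ℝ (Fin n) → ℝ) :
    ∫ x, f x ∂(uniformCube n) = cubeAvg f := by
  rw [uniformCube_eq, integral_smul_measure, setIntegral_finset _ (integrableOn_count_finset _ f),
    Finset.sum_image signVec_injective.injOn, cubeAvg]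
  simp [Measure.real]

theorem cubeAvg_pos {n : ℕ} {f : EuclideanSpace ℝ (Fin n) → ℝ} (hf : ∀ x, 0 < f x) :
    0 < cubeAvg f :=
  mul_pos (by positivity) (Finset.sum_pos (fun _ _ => hf _) Finset.univ_nonempty)

theorem logLaplace_uniformCube {n : ℕ} (l : EuclideanSpace ℝ (Fin n)) :
    logLaplace (uniformCube n) l =
      ((Real.log (cubeAvg fun x => Real.exp ⟪l, x⟫) : ℝ) : EReal) := by
  rw [logLaplace, ← ofReal_integral_eq_lintegral_ofReal (integrable_uniformCube _)
    (Eventually.of_forall fun x => (Real.exp_pos _).le), integral_uniformCube,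
    ENNReal.log_ofReal_of_pos (cubeAvg_pos fun x => Real.exp_pos _)]

theorem legendre_uniformCube {n : ℕ} (x : EuclideanSpace ℝ (Fin n)) :
    legendre (uniformCube n) x = ⨆ l : EuclideanSpace ℝ (Fin n),
      ((⟪l, x⟫ - Real.log (cubeAvg fun z => Real.exp ⟪l, z⟫) : ℝ) : EReal) := by
  simp only [legendre, logLaplace_uniformCube, EReal.coe_sub]

/-- Independence of the coordinates under the uniform measure on the cube. -/
theorem cubeAvg_prod {n : ℕ} (g : Fin n → ℝ → ℝ) :
    cubeAvg (fun x => ∏ i, g i (x i)) = ∏ i, ((g i 1 + g i (-1)) / 2) := by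
  have h : ∏ i, (g i 1 + g i (-1)) =
      ∑ s : Fin n → Bool, ∏ i, g i (if s i then 1 else -1) := by
    have := Finset.prod_univ_sum (fun _ : Fin n => (Finset.univ : Finset Bool))
      (fun i b => g i (if b then 1 else -1))
    simpa only [Fintype.piFinset_univ, Fintype.sum_bool, if_true, Bool.false_eq_true, if_false]
      using this
  rw [Finset.prod_div_distrib, h, cubeAvg]
  simp only [signVec_apply, Finset.prod_const, Finset.card_univ, Fintype.card_fin]
  rw [div_eq_inv_mul]

/-! ### Upper bound for the free energy -/

section UpperBound

variable {n : ℕ} {κ : Type*} [Fintype κ]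

/-- The cell of `x` in the partition of space into slabs of width `√(ε / (δ |λ j|))` orthogonal to
`f j`, for the indices `j` with `|λ j| > ε` only. With at most `δ n` such indices, this width makes
the sum of `|λ j| * width ^ 2` at most `ε n`, while the logarithm of the number of cells that
meet the cube stays small compared with `n` (`card_image_spectralCell_le`). -/
noncomputable def spectralCell (f : κ → EuclideanSpace ℝ (Fin n)) (lam : κ → ℝ) (ε δ : ℝ)
    (x : EuclideanSpace ℝ (Fin n)) (j : {j // ε < |lam j|}) : ℤ :=
  ⌊⟪f j, x⟫ / √(ε / (δ * |lam j|))⌋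

/-- The number of cells that meet the discrete cube. With weights `a j = √(ε / |λ j|) ≤ 1`, the
integer vector of a cell has weighted `ℓ¹` norm at most `2 δ n`, by Cauchy–Schwarz over the at most
`δ n` large indices, so `card_le_exp_of_sum_mul_abs_le` applies. -/
theorem card_image_spectralCell_le (f : κ → EuclideanSpace ℝ (Fin n)) (lam : κ → ℝ)
    (hP : ∀ x, ∑ j, ⟪f j, x⟫ ^ 2 = ‖x‖ ^ 2) {ε δ : ℝ} (hε : 0 < ε) (hδ : 0 < δ)
    (hk : (Fintype.card {j // ε < |lam j|} : ℝ) ≤ δ * n) :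
    ((Finset.univ.image fun s => spectralCell f lam ε δ (signVec s)).card : ℝ) ≤
      Real.exp (2 * δ * n + 2 / ε * ∑ j : {j // ε < |lam j|}, |lam j|) := by
  have hlam : ∀ j : {j // ε < |lam j|}, 0 < |lam j| := fun j => hε.trans j.2
  have ha : ∀ j : {j // ε < |lam j|}, 0 < √(ε / |lam j|) := fun j =>
    Real.sqrt_pos.2 (div_pos hε (hlam j))
  refine (card_le_exp_of_sum_mul_abs_le _ (a := fun j : {j // ε < |lam j|} => √(ε / |lam j|))
    ha (K := 2 * δ * n)
    ?_).trans ?_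
  · intro m hm
    obtain ⟨s, -, rfl⟩ := Finset.mem_image.1 hm
    have hterm : ∀ j : {j // ε < |lam j|},
        √(ε / |lam j|) * |(spectralCell f lam ε δ (signVec s) j : ℝ)| ≤
          √δ * |⟪f j, signVec s⟫| + 1 := by
      intro j
      set t := √(ε / (δ * |lam j|)) with ht
      have htpos : 0 < t := Real.sqrt_pos.2 (div_pos hε (mul_pos hδ (hlam j)))
      have hat : √(ε / |lam j|) = √δ * t := by
        rw [ht, ← Real.sqrt_mul hδ.le]
        congr 1
        field_simp
      have ha1 : √(ε / |lam j|) ≤ 1 := by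
        rw [Real.sqrt_le_one]
        exact (div_le_one (hlam j)).2 j.2.le
      have hfl : |(spectralCell f lam ε δ (signVec s) j : ℝ)| ≤ |⟪f j, signVec s⟫| / t + 1 := by
        have h1 := Int.floor_le (⟪f j, signVec s⟫ / t)
        have h2 := Int.lt_floor_add_one (⟪f j, signVec s⟫ / t)
        have h3 : |⟪f j, signVec s⟫| / t = |⟪f j, signVec s⟫ / t| := by
          rw [abs_div, abs_of_pos htpos]
        rw [h3, spectralCell, abs_le]
        constructor
        · linarith [neg_abs_le (⟪f j, signVec s⟫ / t)]
        · linarith [le_abs_self (⟪f j, signVec s⟫ / t)]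
      calc √(ε / |lam j|) * |(spectralCell f lam ε δ (signVec s) j : ℝ)|
          ≤ √(ε / |lam j|) * (|⟪f j, signVec s⟫| / t + 1) := by gcongr
        _ = √δ * |⟪f j, signVec s⟫| + √(ε / |lam j|) := by
            rw [mul_add, mul_one]
            congr 1
            rw [hat]
            field_simp
        _ ≤ _ := by gcongr
    have hsum : ∑ j : {j // ε < |lam j|}, |⟪f j, signVec s⟫| ≤ √δ * n := by
      have h1 := sq_sum_le_card_mul_sum_sq (s := (Finset.univ : Finset {j // ε < |lam j|}))
        (f := fun j => |⟪f j, signVec s⟫|)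
      have h2 : ∑ j : {j // ε < |lam j|}, |⟪f j, signVec s⟫| ^ 2 ≤ n := by
        rw [← norm_sq_signVec s, ← hP]
        simp only [sq_abs]
        rw [← Fintype.sum_subtype_add_sum_subtype (fun j => ε < |lam j|)]
        exact le_add_of_nonneg_right (Finset.sum_nonneg fun j _ => sq_nonneg _)
      refine abs_le_of_sq_le_sq' ?_ (by positivity) |>.2
      rw [mul_pow, Real.sq_sqrt hδ.le]
      calc _ ≤ _ := h1
        _ ≤ (δ * n) * n := by
            rw [Finset.card_univ]; gcongr
        _ = _ := by ring
    calc _ ≤ ∑ j : {j // ε < |lam j|}, (√δ * |⟪f j, signVec s⟫| + 1) :=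
          Finset.sum_le_sum fun j _ => hterm j
      _ = √δ * ∑ j : {j // ε < |lam j|}, |⟪f j, signVec s⟫| +
            Fintype.card {j // ε < |lam j|} := by
          rw [Finset.sum_add_distrib, Finset.mul_sum]; simp
      _ ≤ √δ * (√δ * n) + δ * n := by gcongr
      _ = 2 * δ * n := by rw [← mul_assoc, Real.mul_self_sqrt hδ.le]; ring
  · gcongr
    rw [Finset.mul_sum]
    refine Finset.sum_le_sum fun j _ => ?_
    rw [div_mul_eq_mul_div, div_le_div_iff₀ (ha j) hε]
    have h1 : 1 ≤ √(|lam j| / ε) := by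
      rw [Real.one_le_sqrt]; exact (one_le_div hε).2 j.2.le
    have h2 : √(ε / |lam j|) * |lam j| = ε * √(|lam j| / ε) := by
      have : √(|lam j| / ε) = (√(ε / |lam j|))⁻¹ := by rw [← Real.sqrt_inv, inv_div]
      rw [this, ← div_eq_mul_inv, eq_div_iff (ha j).ne', mul_right_comm,
        Real.mul_self_sqrt (div_pos hε (hlam j)).le, div_mul_cancel₀ _ (hlam j).ne']
    nlinarith

/-- Inside one cell a quadratic form is almost affine: for any weights on the sign vectors of a
cell, its mean exceeds its value at the mean vector by at most `2 ε n`. The directions with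
`|λ j| ≤ ε` contribute at most `ε` times the second moment `n`, and in the others the width of the
cell bounds the variance. -/
theorem sum_cell_quadratic_sub_le (f : κ → EuclideanSpace ℝ (Fin n)) (lam : κ → ℝ)
    (hP : ∀ x, ∑ j, ⟪f j, x⟫ ^ 2 = ‖x‖ ^ 2) {ε δ : ℝ} (hε : 0 < ε) (hδ : 0 < δ)
    (hk : (Fintype.card {j // ε < |lam j|} : ℝ) ≤ δ * n)
    (S : Finset (Fin n → Bool)) (b : {j // ε < |lam j|} → ℤ)
    (hS : ∀ s ∈ S, spectralCell f lam ε δ (signVec s) = b) {w : (Fin n → Bool) → ℝ}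
    (hw : ∀ s ∈ S, 0 ≤ w s) (hW : 0 < ∑ s ∈ S, w s) :
    ∑ j, lam j * ((∑ s ∈ S, w s * ⟪f j, signVec s⟫ ^ 2) / (∑ s ∈ S, w s) -
      ((∑ s ∈ S, w s * ⟪f j, signVec s⟫) / ∑ s ∈ S, w s) ^ 2) ≤ 2 * ε * n := by
  set W := ∑ s ∈ S, w s with hWdef
  have hterm : ∀ j, lam j * ((∑ s ∈ S, w s * ⟪f j, signVec s⟫ ^ 2) / W -
      ((∑ s ∈ S, w s * ⟪f j, signVec s⟫) / W) ^ 2) ≤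
        (if ε < |lam j| then ε / δ else 0) +
          ε * ((∑ s ∈ S, w s * ⟪f j, signVec s⟫ ^ 2) / W) := by
    intro j
    have hV0 := sum_mul_sq_sub_nonneg S hw hW (fun s => ⟪f j, signVec s⟫)
    have hE0 : 0 ≤ (∑ s ∈ S, w s * ⟪f j, signVec s⟫ ^ 2) / W :=
      div_nonneg (Finset.sum_nonneg fun s hs => mul_nonneg (hw s hs) (sq_nonneg _)) hW.le
    rw [← hWdef] at hV0
    have hle := mul_le_mul_of_nonneg_right (le_abs_self (lam j)) hV0
    refine hle.trans ?_
    split_ifs with hj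
    · have hlam : 0 < |lam j| := hε.trans hj
      set t := √(ε / (δ * |lam j|)) with ht
      have htpos : 0 < t := Real.sqrt_pos.2 (div_pos hε (mul_pos hδ hlam))
      have ht2 : t ^ 2 = ε / (δ * |lam j|) := Real.sq_sqrt (by positivity)
      have hV := sum_mul_sq_sub_le S hW (fun s => ⟪f j, signVec s⟫) (b ⟨j, hj⟩ * t)
      rw [← hWdef] at hV
      have hV2 : (∑ s ∈ S, w s * (⟪f j, signVec s⟫ - b ⟨j, hj⟩ * t) ^ 2) / W ≤ t ^ 2 := by
        rw [div_le_iff₀ hW, hWdef, Finset.mul_sum]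
        refine Finset.sum_le_sum fun s hs => ?_
        have hb : ⌊⟪f j, signVec s⟫ / t⌋ = b ⟨j, hj⟩ := congrFun (hS s hs) ⟨j, hj⟩
        have h1 := Int.floor_le (⟪f j, signVec s⟫ / t)
        have h2 := Int.lt_floor_add_one (⟪f j, signVec s⟫ / t)
        rw [hb] at h1 h2
        rw [le_div_iff₀ htpos] at h1
        rw [div_lt_iff₀ htpos] at h2
        rw [mul_comm]
        refine mul_le_mul_of_nonneg_right ?_ (hw s hs)
        exact pow_le_pow_left₀ (by linarith) (by linarith) 2
      have hV3 := mul_le_mul_of_nonneg_left (hV.trans hV2) hlam.le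
      have : |lam j| * t ^ 2 = ε / δ := by rw [ht2]; field_simp
      rw [this] at hV3
      have := mul_nonneg hε.le hE0
      linarith
    · have hj' : |lam j| ≤ ε := not_lt.1 hj
      rw [zero_add]
      refine mul_le_mul hj' ?_ hV0 hε.le
      linarith [sq_nonneg ((∑ s ∈ S, w s * ⟪f j, signVec s⟫) / W)]
  refine (Finset.sum_le_sum fun j _ => hterm j).trans ?_
  rw [Finset.sum_add_distrib, ← Finset.mul_sum, ← Finset.sum_div, Finset.sum_comm]
  have h1 : ∑ s ∈ S, ∑ j, w s * ⟪f j, signVec s⟫ ^ 2 = n * W := by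
    simp_rw [← Finset.mul_sum, hP, norm_sq_signVec]
    rw [← Finset.sum_mul, mul_comm]
  have h2 : ∑ j, (if ε < |lam j| then ε / δ else 0) ≤ ε * n := by
    rw [← Finset.sum_filter, Finset.sum_const, nsmul_eq_mul, ← Fintype.card_subtype]
    calc _ ≤ δ * n * (ε / δ) := by gcongr
      _ = _ := by field_simp
  rw [h1, mul_div_assoc, div_self hW.ne', mul_one]
  linarith

/-- The mean-field upper bound. The point `y` is the mean of the Gibbs measure conditioned on the
heaviest cell. Jensen's inequality against the tilt `exp ⟪l, ·⟫` bounds the mass of that cell, and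
the number of cells bounds the total mass in terms of it. -/
theorem exists_log_cubeAvg_le (f : κ → EuclideanSpace ℝ (Fin n)) (lam : κ → ℝ)
    (hP : ∀ x, ∑ j, ⟪f j, x⟫ ^ 2 = ‖x‖ ^ 2) {q : EuclideanSpace ℝ (Fin n) → ℝ}
    (hq : ∀ x, q x = ∑ j, lam j * ⟪f j, x⟫ ^ 2) {ε δ : ℝ} (hε : 0 < ε) (hδ : 0 < δ)
    (hk : (Fintype.card {j // ε < |lam j|} : ℝ) ≤ δ * n) :
    ∃ y ∈ solidCube n, ∀ l : EuclideanSpace ℝ (Fin n),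
      Real.log (cubeAvg fun x => Real.exp (q x)) ≤
        q y - (⟪l, y⟫ - Real.log (cubeAvg fun x => Real.exp ⟪l, x⟫)) +
          (2 * ε * n + 2 * δ * n + 2 / ε * ∑ j : {j // ε < |lam j|}, |lam j|) := by
  obtain ⟨b, hne, hb⟩ := exists_sum_le_card_mul_sum_fiber
    (fun s : Fin n → Bool => spectralCell f lam ε δ (signVec s))
    (fun s => Real.exp (q (signVec s)))
  have hcard := card_image_spectralCell_le f lam hP hε hδ hk
  set S := Finset.univ.filter fun s : Fin n → Bool => spectralCell f lam ε δ (signVec s) = b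
    with hSdef
  set N := ((Finset.univ.image fun s : Fin n → Bool =>
    spectralCell f lam ε δ (signVec s)).card : ℝ) with hN
  have hW : 0 < ∑ s ∈ S, Real.exp (q (signVec s)) :=
    Finset.sum_pos (fun s _ => Real.exp_pos _) hne
  have hvar := sum_cell_quadratic_sub_le f lam hP hε hδ hk S b
    (fun s hs => (Finset.mem_filter.1 hs).2) (w := fun s => Real.exp (q (signVec s)))
    (fun s _ => (Real.exp_pos _).le) hW
  set w := fun s : Fin n → Bool => Real.exp (q (signVec s)) with hwdef
  set W := ∑ s ∈ S, w s with hWdef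
  set y : EuclideanSpace ℝ (Fin n) := W⁻¹ • ∑ s ∈ S, w s • signVec s with hy
  have hinner : ∀ l, ⟪l, y⟫ = (∑ s ∈ S, w s * ⟪l, signVec s⟫) / W := by
    intro l
    rw [hy, inner_smul_right, inner_sum, div_eq_inv_mul]
    simp only [inner_smul_right]
  refine ⟨y, ?_, fun l => ?_⟩
  · intro i
    have hyi : y i = (∑ s ∈ S, w s * signVec s i) / W := by
      simp [hy, div_eq_inv_mul]
    have hw0 : ∀ s, 0 ≤ w s := fun s => (Real.exp_pos _).le
    rw [hyi, Set.mem_Icc, le_div_iff₀ hW, div_le_iff₀ hW, hWdef, Finset.mul_sum, Finset.mul_sum]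
    constructor <;> refine Finset.sum_le_sum fun s _ => ?_ <;> rw [signVec_apply] <;>
      split_ifs <;> linarith [hw0 s]
  · have hN0 : 0 < N := by
      rw [hN, Nat.cast_pos, Finset.card_pos]
      exact Finset.univ_nonempty.image _
    -- `hJ` and `hJ2`: the mass of the cell, tilted by `exp (⟪l, ·⟫ - q)`, is at most the full
    -- Laplace transform at `l`.
    have hJ := sum_mul_exp_div_le S (w := w) (g := fun s => ⟪l, signVec s⟫ - q (signVec s))
      (fun s _ => (Real.exp_pos _).le) hW
    rw [← hWdef] at hJ
    have hJ2 : ∑ s ∈ S, w s * Real.exp (⟪l, signVec s⟫ - q (signVec s)) ≤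
        2 ^ n * cubeAvg fun x => Real.exp ⟪l, x⟫ := by
      rw [cubeAvg, mul_inv_cancel_left₀ (by positivity)]
      calc _ = ∑ s ∈ S, Real.exp ⟪l, signVec s⟫ := Finset.sum_congr rfl fun s _ => by
            rw [hwdef, ← Real.exp_add]; congr 1; ring
        _ ≤ _ := Finset.sum_le_univ_sum_of_nonneg fun s => (Real.exp_pos _).le
    have hL := cubeAvg_pos (n := n) (f := fun x => Real.exp ⟪l, x⟫) fun x => Real.exp_pos _
    have h1 := Real.log_le_log (by positivity) (hJ.trans hJ2)
    rw [Real.log_mul hW.ne' (Real.exp_pos _).ne', Real.log_exp,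
      Real.log_mul (by positivity) hL.ne'] at h1
    have h2 : cubeAvg (fun x => Real.exp (q x)) ≤ ((2 : ℝ) ^ n)⁻¹ * (N * W) := by
      rw [cubeAvg]; gcongr
    have h3 := Real.log_le_log (cubeAvg_pos fun x => Real.exp_pos _) h2
    rw [Real.log_mul (by positivity) (by positivity), Real.log_inv,
      Real.log_mul hN0.ne' hW.ne'] at h3
    have h4 : Real.log N ≤ 2 * δ * n + 2 / ε * ∑ j : {j // ε < |lam j|}, |lam j| := by
      rw [← Real.log_exp (2 * δ * n + _)]
      exact Real.log_le_log hN0 hcard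
    have h5 : (∑ s ∈ S, w s * (⟪l, signVec s⟫ - q (signVec s))) / W =
        ⟪l, y⟫ - (∑ s ∈ S, w s * q (signVec s)) / W := by
      rw [hinner, ← sub_div, ← Finset.sum_sub_distrib]
      simp only [mul_sub]
    -- By Parseval diagonalisation this difference is the weighted sum of variances of `hvar`.
    have h6 : (∑ s ∈ S, w s * q (signVec s)) / W - q y ≤ 2 * ε * n := by
      refine le_trans (le_of_eq ?_) hvar
      simp only [mul_sub, Finset.sum_sub_distrib]
      congr 1
      · simp only [← mul_div_assoc, ← Finset.sum_div, Finset.mul_sum]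
        rw [Finset.sum_comm]
        congr 1
        refine Finset.sum_congr rfl fun s _ => ?_
        change w s * q (signVec s) = ∑ j, lam j * (w s * ⟪f j, signVec s⟫ ^ 2)
        generalize w s = c
        rw [hq, Finset.mul_sum]
        exact Finset.sum_congr rfl fun j _ => mul_left_comm _ _ _
      · rw [hq]
        exact Finset.sum_congr rfl fun j _ => by rw [hinner]
    rw [h5] at h1
    linarith

end UpperBound

/-! ### Lower bound for the free energy -/

section LowerBound

variable {n : ℕ}

/-- A quadratic form without diagonal terms is affine in each variable, so its mean under the
product measure `∏ (1 + y i σ i) dμ(σ)`, which has mean `y`, is its value at `y`. -/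
theorem cubeAvg_prod_mul_quadratic {B : Fin n → Fin n → ℝ} (hB : ∀ i, B i i = 0)
    (y : EuclideanSpace ℝ (Fin n)) :
    cubeAvg (fun x => (∏ i, (1 + y i * x i)) * ∑ i, ∑ j, B i j * x i * x j) =
      ∑ i, ∑ j, B i j * y i * y j := by
  have hmom : ∀ i j, i ≠ j → cubeAvg (fun x => (∏ k, (1 + y k * x k)) * (x i * x j)) =
      y i * y j := by
    intro i j hij
    have h : ∀ (u : Fin n → ℝ), (∏ k, if k = i ∨ k = j then u k else 1) = u i * u j := by
      intro u
      rw [← Finset.prod_filter]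
      have : Finset.univ.filter (fun k => k = i ∨ k = j) = {i, j} := by ext; simp
      rw [this, Finset.prod_pair hij]
    have h2 := cubeAvg_prod (fun k z => (1 + y k * z) * if k = i ∨ k = j then z else 1)
    simp only [Finset.prod_mul_distrib] at h2
    rw [← h y]
    convert h2 using 1
    · congr 1; funext x; rw [h]
    · refine Finset.prod_congr rfl fun k _ => ?_
      split_ifs <;> ring
  have hlin : cubeAvg (fun x => (∏ i, (1 + y i * x i)) * ∑ i, ∑ j, B i j * x i * x j) =
      ∑ i, ∑ j, B i j * cubeAvg (fun x => (∏ k, (1 + y k * x k)) * (x i * x j)) := by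
    simp only [cubeAvg, Finset.mul_sum]
    rw [Finset.sum_comm]
    refine Finset.sum_congr rfl fun i _ => ?_
    rw [Finset.sum_comm]
    refine Finset.sum_congr rfl fun j _ => Finset.sum_congr rfl fun s _ => ?_
    ring
  rw [hlin]
  refine Finset.sum_congr rfl fun i _ => Finset.sum_congr rfl fun j _ => ?_
  rcases eq_or_ne i j with rfl | hij
  · simp [hB]
  · rw [hmom i j hij]; ring

theorem cubeAvg_prod_one_add (y : EuclideanSpace ℝ (Fin n)) :
    cubeAvg (fun x => ∏ i, (1 + y i * x i)) = 1 := by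
  rw [cubeAvg_prod (fun i z => 1 + y i * z)]
  exact Finset.prod_eq_one fun i _ => by ring

theorem cubeAvg_prod_mul_inner (l y : EuclideanSpace ℝ (Fin n)) :
    cubeAvg (fun x => (∏ i, (1 + y i * x i)) * ⟪l, x⟫) = ⟪l, y⟫ := by
  have hmom : ∀ i, cubeAvg (fun x => (∏ k, (1 + y k * x k)) * x i) = y i := by
    intro i
    have h : ∀ (u : Fin n → ℝ), (∏ k, if k = i then u k else 1) = u i := by
      intro u; simp
    have h2 := cubeAvg_prod (fun k z => (1 + y k * z) * if k = i then z else 1)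
    simp only [Finset.prod_mul_distrib] at h2
    rw [← h y]
    convert h2 using 1
    · congr 1; funext x; rw [h]
    · refine Finset.prod_congr rfl fun k _ => ?_
      split_ifs <;> ring
  simp only [PiLp.inner_apply, RCLike.inner_apply, conj_trivial]
  have hlin : cubeAvg (fun x => (∏ i, (1 + y i * x i)) * ∑ i, x i * l i) =
      ∑ i, l i * cubeAvg (fun x => (∏ k, (1 + y k * x k)) * x i) := by
    simp only [cubeAvg, Finset.mul_sum]
    rw [Finset.sum_comm]
    refine Finset.sum_congr rfl fun i _ => Finset.sum_congr rfl fun s _ => ?_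
    ring
  rw [hlin]
  exact Finset.sum_congr rfl fun i _ => by rw [hmom, mul_comm]

/-- In the open cube the product measure with mean `y` is an exponential tilt of the uniform
measure, by the vector `artanh y`. -/
theorem exists_exp_inner_eq_prod {y : EuclideanSpace ℝ (Fin n)}
    (hy : ∀ i, y i ∈ Set.Ioo (-1 : ℝ) 1) :
    ∃ l : EuclideanSpace ℝ (Fin n), ∀ s, Real.exp ⟪l, signVec s⟫ =
      (cubeAvg fun x => Real.exp ⟪l, x⟫) * ∏ i, (1 + y i * signVec s i) := by
  refine ⟨WithLp.toLp 2 fun i => Real.artanh (y i), fun s => ?_⟩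
  have hexp : ∀ x : EuclideanSpace ℝ (Fin n),
      Real.exp ⟪(WithLp.toLp 2 fun i => Real.artanh (y i) : EuclideanSpace ℝ (Fin n)), x⟫ =
        ∏ i, Real.exp (x i * Real.artanh (y i)) := by
    intro x
    simp [PiLp.inner_apply, Real.exp_sum]
  simp only [hexp]
  rw [cubeAvg_prod (fun i z => Real.exp (z * Real.artanh (y i))), ← Finset.prod_mul_distrib]
  refine Finset.prod_congr rfl fun i _ => ?_
  have hc : (Real.exp (1 * Real.artanh (y i)) + Real.exp (-1 * Real.artanh (y i))) / 2 =
      Real.cosh (Real.artanh (y i)) := by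
    rw [Real.cosh_eq, one_mul, neg_one_mul]
  have hs : Real.cosh (Real.artanh (y i)) * y i = Real.sinh (Real.artanh (y i)) := by
    have h1 := Real.tanh_artanh (hy i)
    rw [Real.tanh_eq_sinh_div_cosh, div_eq_iff (Real.cosh_pos _).ne'] at h1
    linarith
  rw [hc, mul_add, mul_one, ← mul_assoc, hs, signVec_apply]
  split_ifs
  · rw [one_mul, mul_one, Real.cosh_add_sinh]
  · rw [neg_one_mul, mul_neg_one, ← sub_eq_add_neg, Real.cosh_sub_sinh]

/-- The Gibbs variational principle for the product measure with mean `y`, written as Jensen's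
inequality: for the tilt `l` generating that measure, its relative entropy is `⟪l, y⟫ - Λ(l)`. -/
theorem quadratic_sub_log_cubeAvg_le_of_mem_Ioo {B : Fin n → Fin n → ℝ} (hB : ∀ i, B i i = 0)
    {q : EuclideanSpace ℝ (Fin n) → ℝ} (hq : ∀ x, q x = ∑ i, ∑ j, B i j * x i * x j)
    {y : EuclideanSpace ℝ (Fin n)} (hy : ∀ i, y i ∈ Set.Ioo (-1 : ℝ) 1) :
    ∃ l : EuclideanSpace ℝ (Fin n), q y - Real.log (cubeAvg fun x => Real.exp (q x)) ≤
      ⟪l, y⟫ - Real.log (cubeAvg fun x => Real.exp ⟪l, x⟫) := by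
  obtain ⟨l, hl⟩ := exists_exp_inner_eq_prod hy
  refine ⟨l, ?_⟩
  have hL := cubeAvg_pos (n := n) (f := fun x => Real.exp ⟪l, x⟫) fun x => Real.exp_pos _
  set M := cubeAvg fun x => Real.exp ⟪l, x⟫ with hM
  have hZ := cubeAvg_pos (n := n) (f := fun x => Real.exp (q x)) fun x => Real.exp_pos _
  have hsum1 : ∑ s : Fin n → Bool, ∏ i, (1 + y i * signVec s i) = 2 ^ n := by
    have := cubeAvg_prod_one_add y
    rwa [cubeAvg, inv_mul_eq_iff_eq_mul₀ (by positivity), mul_one] at this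
  have hsumq : ∑ s : Fin n → Bool, (∏ i, (1 + y i * signVec s i)) * q (signVec s) =
      2 ^ n * q y := by
    have := cubeAvg_prod_mul_quadratic hB y
    simp only [← hq] at this
    rwa [cubeAvg, inv_mul_eq_iff_eq_mul₀ (by positivity)] at this
  have hsuml : ∑ s : Fin n → Bool, (∏ i, (1 + y i * signVec s i)) * ⟪l, signVec s⟫ =
      2 ^ n * ⟪l, y⟫ := by
    have := cubeAvg_prod_mul_inner l y
    rwa [cubeAvg, inv_mul_eq_iff_eq_mul₀ (by positivity)] at this
  have hprod : ∀ s : Fin n → Bool, ∏ i, (1 + y i * signVec s i) =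
      M⁻¹ * Real.exp ⟪l, signVec s⟫ := fun s => by rw [hl, inv_mul_cancel_left₀ hL.ne']
  have hJ := sum_mul_exp_div_le Finset.univ
    (w := fun s : Fin n → Bool => ∏ i, (1 + y i * signVec s i))
    (g := fun s => q (signVec s) - ⟪l, signVec s⟫)
    (fun s _ => by rw [hprod]; positivity) (by rw [hsum1]; positivity)
  simp only [mul_sub, Finset.sum_sub_distrib] at hJ
  rw [hsum1, hsumq, hsuml, ← mul_sub, mul_div_cancel_left₀ _ (by positivity)] at hJ
  have hR : ∑ s : Fin n → Bool, (∏ i, (1 + y i * signVec s i)) *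
      Real.exp (q (signVec s) - ⟪l, signVec s⟫) =
        2 ^ n * (M⁻¹ * cubeAvg fun x => Real.exp (q x)) := by
    rw [cubeAvg, mul_left_comm M⁻¹, mul_inv_cancel_left₀ (by positivity), Finset.mul_sum]
    refine Finset.sum_congr rfl fun s _ => ?_
    rw [hprod, mul_assoc, ← Real.exp_add]
    congr 2; ring
  rw [hR] at hJ
  have h1 := Real.log_le_log (Real.exp_pos _) (le_of_mul_le_mul_left hJ (by positivity))
  rw [Real.log_exp, Real.log_mul (by positivity) hZ.ne', Real.log_inv] at h1
  linarith

theorem log_cubeAvg_exp_inner_nonneg (l : EuclideanSpace ℝ (Fin n)) :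
    0 ≤ Real.log (cubeAvg fun x => Real.exp ⟪l, x⟫) := by
  refine Real.log_nonneg ?_
  have hexp : ∀ x : EuclideanSpace ℝ (Fin n),
      Real.exp ⟪l, x⟫ = ∏ i, Real.exp (x i * l i) := by
    intro x
    simp [PiLp.inner_apply, Real.exp_sum]
  simp only [hexp]
  rw [cubeAvg_prod (fun i z => Real.exp (z * l i))]
  refine Finset.one_le_prod fun i _ => ?_
  rw [one_mul, neg_one_mul, ← Real.cosh_eq]
  exact Real.one_le_cosh _

/-- The mean-field lower bound on the closed cube. Points of the boundary are not means of tilts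
of the uniform measure; they are reached along `t • y` as `t → 1`, using that the Legendre transform
does not increase when its argument is scaled by `t`. -/
theorem quadratic_sub_legendre_le {B : Fin n → Fin n → ℝ} (hB : ∀ i, B i i = 0)
    {q : EuclideanSpace ℝ (Fin n) → ℝ} (hq : ∀ x, q x = ∑ i, ∑ j, B i j * x i * x j)
    {y : EuclideanSpace ℝ (Fin n)} (hy : y ∈ solidCube n) :
    ((q y : ℝ) : EReal) - legendre (uniformCube n) y ≤
      ((Real.log (cubeAvg fun x => Real.exp (q x)) : ℝ) : EReal) := by
  set F := Real.log (cubeAvg fun x => Real.exp (q x)) with hF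
  have hscale : ∀ t ∈ Set.Ioo (0 : ℝ) 1,
      ((t ^ 2 * q y - F : ℝ) : EReal) ≤ legendre (uniformCube n) y := by
    intro t ht
    have hty : ∀ i, (t • y) i ∈ Set.Ioo (-1 : ℝ) 1 := by
      intro i
      have h := hy i
      simp only [PiLp.smul_apply, smul_eq_mul, Set.mem_Ioo, Set.mem_Icc] at h ⊢
      constructor <;> nlinarith [ht.1, ht.2, h.1, h.2]
    obtain ⟨l, hl⟩ := quadratic_sub_log_cubeAvg_le_of_mem_Ioo hB hq hty
    have hqt : q (t • y) = t ^ 2 * q y := by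
      simp only [hq, Finset.mul_sum, PiLp.smul_apply, smul_eq_mul]
      exact Finset.sum_congr rfl fun i _ => Finset.sum_congr rfl fun j _ => by ring
    rw [hqt, inner_smul_right, ← hF] at hl
    have hΛ := log_cubeAvg_exp_inner_nonneg l
    rw [legendre_uniformCube]
    -- If `⟪l, y⟫ ≥ 0`, replacing `t • y` by `y` increases the affine bound of `l`; otherwise that
    -- bound is negative and `l = 0` does better.
    by_cases hpos : 0 ≤ ⟪l, y⟫
    · refine le_trans ?_ (le_iSup _ l)
      rw [EReal.coe_le_coe_iff]
      nlinarith [ht.2]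
    · refine le_trans ?_ (le_iSup _ 0)
      rw [EReal.coe_le_coe_iff]
      have h0 : cubeAvg (fun z : EuclideanSpace ℝ (Fin n) => Real.exp ⟪0, z⟫) = 1 := by
        simp [cubeAvg]
      rw [h0, inner_zero_left, Real.log_one]
      nlinarith [ht.1]
  have hlim : ((q y - F : ℝ) : EReal) ≤ legendre (uniformCube n) y := by
    have h1 : Tendsto (fun t : ℝ => ((t ^ 2 * q y - F : ℝ) : EReal)) (𝓝[<] 1)
        (𝓝 ((q y - F : ℝ) : EReal)) := by
      have h2 : Continuous fun t : ℝ => ((t ^ 2 * q y - F : ℝ) : EReal) :=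
        continuous_coe_real_ereal.comp (by fun_prop)
      have := (h2.tendsto 1).mono_left (nhdsWithin_le_nhds (s := Set.Iio 1))
      simpa only [one_pow, one_mul] using this
    refine le_of_tendsto h1 ?_
    filter_upwards [Ioo_mem_nhdsLT (zero_lt_one' ℝ)] with t ht using hscale t ht
  refine EReal.sub_le_of_le_add' ?_
  calc ((q y : ℝ) : EReal) = ((q y - F : ℝ) : EReal) + (F : EReal) := by
        rw [← EReal.coe_add]; simp
    _ ≤ _ := by gcongr

end LowerBound

/-! ### The quadratic form in an eigenbasis -/

section Spectral

variable {n : ℕ} {A : Matrix (Fin n) (Fin n) ℂ}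

/-- The real parts (index `true`) and imaginary parts (index `false`) of the eigenvectors of a
Hermitian matrix. They form a Parseval frame of `ℝ^n`. -/
noncomputable def eigenFrame (hA : A.IsHermitian) (j : Fin n × Bool) :
    EuclideanSpace ℝ (Fin n) :=
  WithLp.toLp 2 fun k =>
    if j.2 then (hA.eigenvectorBasis j.1 k).re else (hA.eigenvectorBasis j.1 k).im

/-- A real vector seen as a complex one. -/
noncomputable def complexify (x : EuclideanSpace ℝ (Fin n)) : EuclideanSpace ℂ (Fin n) :=
  WithLp.toLp 2 fun k => (x k : ℂ)

theorem norm_inner_eigenvectorBasis_sq (hA : A.IsHermitian) (x : EuclideanSpace ℝ (Fin n))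
    (i : Fin n) :
    ‖inner ℂ (hA.eigenvectorBasis i) (complexify x)‖ ^ 2 =
      ⟪eigenFrame hA (i, true), x⟫ ^ 2 + ⟪eigenFrame hA (i, false), x⟫ ^ 2 := by
  have h1 : (inner ℂ (hA.eigenvectorBasis i) (complexify x)).re =
      ⟪eigenFrame hA (i, true), x⟫ := by
    simp [PiLp.inner_apply, complexify, eigenFrame]
  have h2 : (inner ℂ (hA.eigenvectorBasis i) (complexify x)).im =
      -⟪eigenFrame hA (i, false), x⟫ := by
    simp [PiLp.inner_apply, complexify, eigenFrame]
  rw [← Complex.normSq_eq_norm_sq, Complex.normSq_apply, h1, h2]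
  ring

theorem sum_inner_eigenFrame_sq (hA : A.IsHermitian) (x : EuclideanSpace ℝ (Fin n)) :
    ∑ j, ⟪eigenFrame hA j, x⟫ ^ 2 = ‖x‖ ^ 2 := by
  rw [Fintype.sum_prod_type]
  simp only [Fintype.sum_bool, ← norm_inner_eigenvectorBasis_sq]
  rw [OrthonormalBasis.sum_sq_norm_inner_right, EuclideanSpace.norm_sq_eq,
    EuclideanSpace.norm_sq_eq]
  simp [complexify]

theorem quadForm_eq_sum_eigenFrame (hA : A.IsHermitian) (x : EuclideanSpace ℝ (Fin n)) :
    quadForm A x = ∑ j, hA.eigenvalues j.1 * ⟪eigenFrame hA j, x⟫ ^ 2 := by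
  rw [Fintype.sum_prod_type]
  simp only [Fintype.sum_bool, ← mul_add, ← norm_inner_eigenvectorBasis_sq]
  have hsymm := Matrix.isSymmetric_toEuclideanLin_iff.2 hA
  have hform : quadForm A x =
      (inner ℂ (complexify x) (Matrix.toEuclideanLin A (complexify x))).re := by
    rw [quadForm, EuclideanSpace.inner_eq_star_dotProduct, dotProduct_comm]
    rfl
  rw [hform, ← OrthonormalBasis.sum_inner_mul_inner hA.eigenvectorBasis, Complex.re_sum]
  refine Finset.sum_congr rfl fun i _ => ?_
  have heig : Matrix.toEuclideanLin A (hA.eigenvectorBasis i) =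
      (hA.eigenvalues i : ℂ) • hA.eigenvectorBasis i := by
    have := hA.mulVec_eigenvectorBasis i
    ext k
    simpa using congrFun this k
  rw [← hsymm, heig, inner_smul_left, Complex.conj_ofReal, mul_left_comm,
    ← inner_conj_symm, ← Complex.normSq_eq_conj_mul_self, ← Complex.ofReal_mul,
    Complex.ofReal_re, Complex.normSq_eq_norm_sq]

/-- Real vectors only see the real part of the matrix. -/
theorem quadForm_eq_sum_re (x : EuclideanSpace ℝ (Fin n)) :
    quadForm A x = ∑ i, ∑ j, (A i j).re * x i * x j := by
  simp only [quadForm, dotProduct, Matrix.mulVec, Complex.re_sum, Finset.mul_sum]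
  refine Finset.sum_congr rfl fun i _ => Finset.sum_congr rfl fun j _ => ?_
  simp
  ring

theorem trace_sq_re_eq_sum_eigenvalues_sq (hA : A.IsHermitian) :
    (A ^ 2).trace.re = ∑ i, hA.eigenvalues i ^ 2 := by
  have h : A ^ 2 = (hA.eigenvectorUnitary : Matrix (Fin n) (Fin n) ℂ) *
      Matrix.diagonal (fun i => (hA.eigenvalues i : ℂ)) ^ 2 *
        star (hA.eigenvectorUnitary : Matrix (Fin n) (Fin n) ℂ) := by
    conv_lhs => rw [hA.spectral_theorem, ← map_pow]
    rfl
  rw [h, Matrix.trace_mul_comm, ← mul_assoc, Unitary.coe_star_mul_self, one_mul,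
    Matrix.diagonal_pow, Matrix.trace_diagonal, Complex.re_sum]
  refine Finset.sum_congr rfl fun i _ => ?_
  simp [← Complex.ofReal_pow]

end Spectral

/-! ### Comparison of the free energy with the mean-field value -/

section MeanField

variable {n : ℕ} {A : Matrix (Fin n) (Fin n) ℂ}

/-- The mean-field functional never exceeds the free energy. -/
theorem iSup_quadForm_sub_legendre_le (hdiag : ∀ i, A i i = 0) :
    (⨆ x ∈ solidCube n, ((quadForm A x : ℝ) : EReal) - legendre (uniformCube n) x) ≤
      ((Real.log (cubeAvg fun x => Real.exp (quadForm A x)) : ℝ) : EReal) :=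
  iSup₂_le fun _ hx => quadratic_sub_legendre_le (B := fun i j => (A i j).re)
    (fun i => by simp [hdiag i]) quadForm_eq_sum_re hx

/-- The free energy exceeds the mean-field value by at most an amount controlled by the number of
eigenvalues outside `[-ε, ε]` and by the Hilbert–Schmidt norm. -/
theorem log_cubeAvg_exp_quadForm_le (hA : A.IsHermitian) {ε δ : ℝ} (hε : 0 < ε) (hδ : 0 < δ)
    (hk : (Fintype.card {i // ε < |hA.eigenvalues i|} : ℝ) ≤ δ * n) :
    ((Real.log (cubeAvg fun x => Real.exp (quadForm A x)) : ℝ) : EReal) ≤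
      (⨆ x ∈ solidCube n, ((quadForm A x : ℝ) : EReal) - legendre (uniformCube n) x) +
        ((2 * ε * n + 4 * δ * n + 4 / ε * √(δ * n * (A ^ 2).trace.re) : ℝ) : EReal) := by
  -- Every eigenvalue occurs twice in the real frame, hence `2 * δ` and `2 * tr A²` below.
  set lam : Fin n × Bool → ℝ := fun j => hA.eigenvalues j.1 with hlam
  have hcard : (Fintype.card {j // ε < |lam j|} : ℝ) ≤ 2 * δ * n := by
    have h : Fintype.card {j // ε < |lam j|} =
        2 * Fintype.card {i // ε < |hA.eigenvalues i|} := by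
      rw [Fintype.card_subtype, Fintype.card_subtype]
      have : (Finset.univ.filter fun j : Fin n × Bool => ε < |lam j|) =
          (Finset.univ.filter fun i => ε < |hA.eigenvalues i|) ×ˢ Finset.univ := by
        ext ⟨i, b⟩; simp [hlam]
      rw [this, Finset.card_product, mul_comm]; simp
    rw [h]; push_cast; linarith
  have htr : ∑ j : {j // ε < |lam j|}, |lam j| ≤ 2 * √(δ * n * (A ^ 2).trace.re) := by
    have h1 := sq_sum_le_card_mul_sum_sq (s := (Finset.univ : Finset {j // ε < |lam j|}))
      (f := fun j => |lam j|)
    have h2 : ∑ j : {j // ε < |lam j|}, |lam j| ^ 2 ≤ 2 * (A ^ 2).trace.re := by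
      have h3 : ∑ j, lam j ^ 2 = 2 * (A ^ 2).trace.re := by
        rw [trace_sq_re_eq_sum_eigenvalues_sq hA, Fintype.sum_prod_type, Finset.mul_sum]
        simp [hlam, two_mul]
      rw [← h3, ← Fintype.sum_subtype_add_sum_subtype (fun j => ε < |lam j|)]
      simp only [sq_abs]
      exact le_add_of_nonneg_right (Finset.sum_nonneg fun j _ => sq_nonneg _)
    have htr0 : 0 ≤ (A ^ 2).trace.re := by
      rw [trace_sq_re_eq_sum_eigenvalues_sq hA]
      exact Finset.sum_nonneg fun i _ => sq_nonneg _
    refine (abs_le_of_sq_le_sq' ?_ (by positivity)).2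
    rw [mul_pow, Real.sq_sqrt (by positivity)]
    calc _ ≤ _ := h1
      _ ≤ (2 * δ * n) * (2 * (A ^ 2).trace.re) := by
          rw [Finset.card_univ]; gcongr
      _ = _ := by ring
  obtain ⟨y, hy, hyl⟩ := exists_log_cubeAvg_le (eigenFrame hA) lam (sum_inner_eigenFrame_sq hA)
    (quadForm_eq_sum_eigenFrame hA) hε (δ := 2 * δ) (by positivity) hcard
  set F := Real.log (cubeAvg fun x => Real.exp (quadForm A x)) with hF
  set err := 2 * ε * n + 4 * δ * n + 4 / ε * √(δ * n * (A ^ 2).trace.re) with herr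
  have hleg : legendre (uniformCube n) y ≤ ((quadForm A y + err - F : ℝ) : EReal) := by
    rw [legendre_uniformCube]
    refine iSup_le fun l => ?_
    rw [EReal.coe_le_coe_iff]
    have h1 := hyl l
    have h2 : 2 / ε * ∑ j : {j // ε < |lam j|}, |lam j| ≤
        4 / ε * √(δ * n * (A ^ 2).trace.re) := by
      calc _ ≤ 2 / ε * (2 * √(δ * n * (A ^ 2).trace.re)) := by gcongr
        _ = _ := by ring
    linarith
  have hval : ((F - err : ℝ) : EReal) ≤
      ⨆ x ∈ solidCube n, ((quadForm A x : ℝ) : EReal) - legendre (uniformCube n) x := by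
    refine le_trans ?_ (le_iSup₂ y hy)
    calc ((F - err : ℝ) : EReal) =
          ((quadForm A y : ℝ) : EReal) - ((quadForm A y + err - F : ℝ) : EReal) := by
            rw [← EReal.coe_sub]; congr 1; ring
      _ ≤ _ := EReal.sub_le_sub le_rfl hleg
  calc (F : EReal) = ((F - err : ℝ) : EReal) + (err : EReal) := by
        rw [← EReal.coe_add]; congr 1; ring
    _ ≤ _ := by gcongr

/-- The difference between the free energy and its mean-field approximation is a nonnegative real
number, subject to the bound of `log_cubeAvg_exp_quadForm_le`. -/
theorem exists_log_integral_eq_iSup_add (hA : A.IsHermitian) (hdiag : ∀ i, A i i = 0) :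
    ∃ r : ℝ, 0 ≤ r ∧
      ((Real.log (∫ σ, Real.exp (quadForm A σ) ∂(uniformCube n)) : ℝ) : EReal) =
        (⨆ x ∈ solidCube n, ((quadForm A x : ℝ) : EReal) - legendre (uniformCube n) x) +
          (r : EReal) ∧
      ∀ ε δ : ℝ, 0 < ε → 0 < δ →
        (Fintype.card {i // ε < |hA.eigenvalues i|} : ℝ) ≤ δ * n →
        r ≤ 2 * ε * n + 4 * δ * n + 4 / ε * √(δ * n * (A ^ 2).trace.re) := by
  have hup := iSup_quadForm_sub_legendre_le hdiag
  have hlow := fun (ε δ : ℝ) (hε : 0 < ε) (hδ : 0 < δ) hk =>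
    log_cubeAvg_exp_quadForm_le hA (ε := ε) (δ := δ) hε hδ hk
  -- The instance `ε = δ = 1` is always available and shows that the supremum is not `⊥`.
  have hone := hlow 1 1 one_pos one_pos (by
    rw [one_mul, Nat.cast_le]
    exact (Fintype.card_subtype_le _).trans (Fintype.card_fin n).le)
  rw [integral_uniformCube]
  generalize (⨆ x ∈ solidCube n,
    ((quadForm A x : ℝ) : EReal) - legendre (uniformCube n) x) = S at *
  induction S with
  | bot => simp at hone
  | top => simp at hup
  | coe S =>
    refine ⟨Real.log (cubeAvg fun x => Real.exp (quadForm A x)) - S, ?_, ?_, ?_⟩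
    · exact sub_nonneg.2 (EReal.coe_le_coe_iff.1 hup)
    · rw [← EReal.coe_add]; congr 1; ring
    · intro ε δ hε hδ hk
      have := hlow ε δ hε hδ hk
      rw [← EReal.coe_add, EReal.coe_le_coe_iff] at this
      linarith

end MeanField

/-! ### Spectral counting and the limit -/

/-- Weak convergence of the spectral measures to `δ₀`: the proportion of eigenvalues outside
`[-ε, ε]` tends to zero. -/
theorem eventually_card_eigenvalues_le (A : (n : ℕ) → Matrix (Fin n) (Fin n) ℂ)
    (hA : ∀ n, (A n).IsHermitian)
    (hweak : Tendsto (fun n => empiricalSpectralMeasure (hA n)) atTop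
      (𝓝 (diracProba (0 : ℝ)).toFiniteMeasure)) {ε δ : ℝ} (hε : 0 < ε) (hδ : 0 < δ) :
    ∀ᶠ n : ℕ in atTop,
      (Fintype.card {i // ε < |(hA n).eigenvalues i|} : ℝ) ≤ δ * n := by
  -- A bounded continuous function that vanishes at `0` and is `1` outside `[-ε, ε]`.
  let φ : BoundedContinuousFunction ℝ ℝ := BoundedContinuousFunction.ofNormedAddCommGroup
    (fun x => min (|x| / ε) 1) (by fun_prop) 1 (fun x => by
      rw [Real.norm_eq_abs, abs_of_nonneg (le_min (by positivity) zero_le_one)]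
      exact min_le_right _ _)
  have hφ : ∀ x, φ x = min (|x| / ε) 1 := fun _ => rfl
  have h := (FiniteMeasure.tendsto_iff_forall_integral_tendsto.1 hweak) φ
  have h0 : ∫ x, φ x ∂((diracProba (0 : ℝ)).toFiniteMeasure : Measure ℝ) = 0 := by
    change ∫ x, φ x ∂(Measure.dirac (0 : ℝ)) = 0
    rw [integral_dirac, hφ]; simp
  rw [h0] at h
  have hint : ∀ n, ∫ x, φ x ∂(empiricalSpectralMeasure (hA n) : Measure ℝ) =
      (n : ℝ)⁻¹ * ∑ i, φ ((hA n).eigenvalues i) := by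
    intro n
    have : (empiricalSpectralMeasure (hA n) : Measure ℝ) =
        ((n : ℝ≥0)⁻¹) • ∑ i, Measure.dirac ((hA n).eigenvalues i) := by
      rw [empiricalSpectralMeasure, FiniteMeasure.toMeasure_smul, FiniteMeasure.toMeasure_sum]
      rfl
    rw [this, integral_smul_nnreal_measure, integral_finsetSum_measure]
    · simp [NNReal.smul_def]
    · intro i _
      exact φ.integrable _
  filter_upwards [h.eventually_lt_const hδ, eventually_gt_atTop 0] with n hn hn0
  rw [hint, inv_mul_lt_iff₀ (by positivity)] at hn
  rw [mul_comm]
  refine le_trans ?_ hn.le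
  rw [← Fintype.sum_subtype_add_sum_subtype (fun i => ε < |(hA n).eigenvalues i|)]
  have h1 : ∀ i : {i // ε < |(hA n).eigenvalues i|}, φ ((hA n).eigenvalues i) = 1 := by
    intro i
    rw [hφ]
    exact min_eq_right ((one_le_div hε).2 i.2.le)
  simp only [h1]
  refine le_trans (by simp) (le_add_of_nonneg_right (Finset.sum_nonneg fun i _ => ?_))
  rw [hφ]
  exact le_min (by positivity) zero_le_one

end MeanFieldIsing

theorem mainTheorem6
    (A : (n : ℕ) → Matrix (Fin n) (Fin n) ℂ)
    (hA : ∀ n, (A n).IsHermitian)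
    (hdiag : ∀ n, ∀ i : Fin n, A n i i = 0)
    (hweak : Tendsto (fun n => MeanFieldIsing.empiricalSpectralMeasure (hA n)) atTop
      (𝓝 (diracProba (0 : ℝ)).toFiniteMeasure))
    (htrace : limsup (fun n : ℕ => (((n : ℝ)⁻¹ * ((A n) ^ 2).trace.re : ℝ) : EReal)) atTop < ⊤) :
    ∃ r : ℕ → ℝ, r =o[atTop] (fun n : ℕ => (n : ℝ)) ∧
      ∀ n : ℕ,
        ((Real.log (∫ σ, Real.exp (MeanFieldIsing.quadForm (A n) σ)
            ∂(MeanFieldIsing.uniformCube n)) : ℝ) : EReal) =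
          (⨆ x ∈ MeanFieldIsing.solidCube n,
            ((MeanFieldIsing.quadForm (A n) x : ℝ) : EReal) -
              MeanFieldIsing.legendre (MeanFieldIsing.uniformCube n) x) + ((r n : ℝ) : EReal) := by
  choose r hr0 hr hbound using fun n =>
    MeanFieldIsing.exists_log_integral_eq_iSup_add (hA n) (hdiag n)
  refine ⟨r, ?_, hr⟩
  obtain ⟨C, hC, -⟩ := EReal.lt_iff_exists_real_btwn.1 htrace
  rw [Asymptotics.isLittleO_iff]
  intro c hc
  have hε : 0 < c / 4 := by positivity
  -- With `ε = c / 4`, the term `2 ε n` uses half of `c n`; a small `δ` puts the rest into the other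
  -- half.
  obtain ⟨δ, hδ, hδ0⟩ : ∃ δ : ℝ, 4 * δ + 4 / (c / 4) * √(δ * C) < c / 2 ∧ 0 < δ := by
    have hcont : Continuous fun δ : ℝ => 4 * δ + 4 / (c / 4) * √(δ * C) := by fun_prop
    have h := (hcont.tendsto 0).mono_left (nhdsWithin_le_nhds (s := Set.Ioi 0))
    have h0 : 4 * (0 : ℝ) + 4 / (c / 4) * √(0 * C) < c / 2 := by simp [hc]
    exact ((h.eventually_lt_const h0).and self_mem_nhdsWithin).exists
  filter_upwards [eventually_lt_of_limsup_lt hC,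
    MeanFieldIsing.eventually_card_eigenvalues_le A hA hweak hε hδ0,
    eventually_gt_atTop 0] with n hn hk hn0
  have hn0' : (0 : ℝ) < n := by exact_mod_cast hn0
  rw [EReal.coe_lt_coe_iff, inv_mul_lt_iff₀ hn0'] at hn
  rw [Real.norm_eq_abs, Real.norm_eq_abs, abs_of_nonneg (hr0 n), abs_of_pos hn0']
  refine (hbound n (c / 4) δ hε hδ0 hk).trans ?_
  have hsqrt : √(δ * n * ((A n) ^ 2).trace.re) ≤ n * √(δ * C) := by
    calc √(δ * n * ((A n) ^ 2).trace.re) ≤ √(n ^ 2 * (δ * C)) := by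
          apply Real.sqrt_le_sqrt
          calc δ * n * ((A n) ^ 2).trace.re ≤ δ * n * (n * C) := by gcongr
            _ = _ := by ring
      _ = n * √(δ * C) := by rw [Real.sqrt_mul (by positivity), Real.sqrt_sq hn0'.le]
  calc 2 * (c / 4) * n + 4 * δ * n + 4 / (c / 4) * √(δ * n * ((A n) ^ 2).trace.re)
      ≤ 2 * (c / 4) * n + 4 * δ * n + 4 / (c / 4) * (n * √(δ * C)) := by gcongr
    _ = (c / 2 + (4 * δ + 4 / (c / 4) * √(δ * C))) * n := by ring
    _ ≤ (c / 2 + c / 2) * n := by gcongr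
    _ = c * n := by ring
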